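/- For a finite simple graph $G$ let $c(G)$ denote the number of cycles in $G$, i.e. the number of (not necessarily induced) subgraphs of $G$ isomorphic to a cycle $C_m$ for some $m\ge 3$. A graph is $C_{2k+1}$-free if it has no subgraph (induced or not) isomorphic to $C_{2k+1}$. For every integer $k\ge 2$ there is a real constant $\alpha_{2k+1}\ge 1$, depending only on $k$, such that for every $n\ge 4$: if $G$ is a $C_{2k+1}$-free graph on $n$ vertices having the maximum number of cycles among all $C_{2k+1}$-free graphs on $n$ vertices, then $$c(G)\le \alpha_{2k+1}\cdot c\bigl(K_{\lceil n/2\rceil,\lfloor n/2\rfloor}\bigr).$$ -/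

import Mathlib

/-- The number `c(G)` of cycles of a finite graph `G`: the number of (not necessarily induced)
subgraphs of `G` that are isomorphic to a cycle `C_m`, summed over all lengths `m ≥ 3`; no cycle
is longer than the number of vertices. -/
noncomputable def numCycles {V : Type*} [Fintype V] (G : SimpleGraph V) : ℕ :=
  ∑ m ∈ Finset.Icc 3 (Fintype.card V), G.copyCount (SimpleGraph.cycleGraph m)

/-- `G` is `H`-free (it has no subgraph, induced or not, isomorphic to `H`) and has the maximum
number of cycles among all `H`-free graphs on the same vertex set. -/
def IsCycleMaximalFree {V W : Type*} [Fintype V] (H : SimpleGraph W) (G : SimpleGraph V) : Prop :=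
  H.Free G ∧ ∀ G' : SimpleGraph V, H.Free G' → numCycles G' ≤ numCycles G

/-- The balanced complete bipartite graph on `n` vertices, with parts of sizes `⌈n/2⌉` and
`⌊n/2⌋`. -/
def balancedCompleteBipartite (n : ℕ) : SimpleGraph (Fin ((n + 1) / 2) ⊕ Fin (n / 2)) :=
  completeBipartiteGraph (Fin ((n + 1) / 2)) (Fin (n / 2))

open Finset SimpleGraph


/-! A `C_L`-free graph spans at most `⌊s²/4⌋ + C` edges on every set of `s` vertices
(`degSum_le_of_free`): if all degrees inside a set exceed half its size, the Dirac and Bondy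
arguments give a `C_L`; otherwise a low-degree vertex is deleted.

Extending a path from its end multiplies the count by a degree into the unused vertices. The edge
bound on all subsets keeps the product of these degrees within a factor `exp (1 + C)` of its
bipartite value `halfProd s` (`card_pathsFrom_le_exp`). Rooting each cycle at a chosen vertex of its
vertex set bounds the cycles on `l` vertices by `n.choose l * halfProd l * exp (1 + C)`, and the sum
over `l` is `O(halfProd n)` (`sum_choose_mul_halfProd_le`). Conversely the longest cycles of the
balanced complete bipartite graph already number at least `halfProd n / 4`
(`halfProd_le_numCycles`). -/

/-! ### Cycles as closed sequences -/

theorem cycleGraph_adj_iff_val {L : ℕ} (hL : 2 ≤ L) (u v : Fin L) :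
    (cycleGraph L).Adj u v ↔ u.val + 1 = v.val ∨ v.val + 1 = u.val ∨
      (u.val = 0 ∧ v.val + 1 = L) ∨ (v.val = 0 ∧ u.val + 1 = L) := by
  rw [cycleGraph_adj']
  have hu := u.isLt
  have hv := v.isLt
  rcases le_total u v with h | h
  · rcases eq_or_lt_of_le h with rfl | h
    · have := Fin.sub_val_of_le h
      omega
    · rw [Fin.sub_val_of_le h.le, Fin.coe_sub_iff_lt.mpr h]
      have := Fin.lt_def.mp h
      omega
  · rcases eq_or_lt_of_le h with rfl | h
    · have := Fin.sub_val_of_le h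
      omega
    · rw [Fin.sub_val_of_le h.le, Fin.coe_sub_iff_lt.mpr h]
      have := Fin.lt_def.mp h
      omega

/-- A closed sequence of `L` distinct, consecutively adjacent vertices, as a copy of the cycle
of length `L`. -/
def cycleCopyOfSeq {V : Type*} {G : SimpleGraph V} {L : ℕ} (hL : 2 ≤ L) (f : ℕ → V)
    (inj : ∀ i < L, ∀ j < L, f i = f j → i = j)
    (adj : ∀ i, i + 1 < L → G.Adj (f i) (f (i + 1)))
    (close : G.Adj (f (L - 1)) (f 0)) : Copy (cycleGraph L) G where
  toHom :=
    { toFun := fun i => f i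
      map_rel' := by
        intro a b h
        have ha := a.isLt
        have hb := b.isLt
        rcases (cycleGraph_adj_iff_val hL a b).1 h with h | h | ⟨h, h'⟩ | ⟨h, h'⟩
        · simpa [h] using adj a (by omega)
        · simpa [h] using (adj b (by omega)).symm
        · have : b.val = L - 1 := by omega
          simpa [h, this] using close.symm
        · have : a.val = L - 1 := by omega
          simpa [h, this] using close }
  injective' := fun a b h => Fin.ext (inj a a.isLt b b.isLt h)

/-- `f 0, …, f (p - 1)` are distinct vertices of `S`, each adjacent to the next one. -/
structure IsPathSeq {V : Type*} (G : SimpleGraph V) (S : Finset V) (p : ℕ) (f : ℕ → V) :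
    Prop where
  mem : ∀ i < p, f i ∈ S
  inj : ∀ i < p, ∀ j < p, f i = f j → i = j
  adj : ∀ i, i + 1 < p → G.Adj (f i) (f (i + 1))

open Classical in
/-- The number of neighbours of `x` in `S`. -/
noncomputable def degIn {V : Type*} (G : SimpleGraph V) (S : Finset V) (x : V) : ℕ :=
  #{y ∈ S | G.Adj x y}

/-! ### Longest paths and cycles of prescribed length -/

section LongestPath

variable {V : Type*} {G : SimpleGraph V} {S : Finset V} {p : ℕ} {f : ℕ → V}

theorem IsPathSeq.le_card (h : IsPathSeq G S p f) : p ≤ #S := by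
  have := card_le_card_of_injOn (s := range p) f (t := S) (fun i hi => h.mem i (by simpa using hi))
    (fun i hi j hj e => h.inj i (by simpa using hi) j (by simpa using hj) e)
  simpa using this

theorem IsPathSeq.cons (h : IsPathSeq G S p f) (hp : 0 < p) {y : V} (hy : y ∈ S)
    (hadj : G.Adj (f 0) y) (hne : ∀ i < p, f i ≠ y) :
    IsPathSeq G S (p + 1) (fun i => if i = 0 then y else f (i - 1)) where
  mem i hi := by
    split_ifs
    · exact hy
    · exact h.mem _ (by omega)
  inj i hi j hj e := by
    have := h.inj (i - 1) 
    have := this (by omega) (j - 1) (by omega)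
    have h1 := hne (i - 1) 
    have h2 := hne (j - 1) 
    grind
  adj i hi := by
    by_cases hi0 : i = 0
    · simpa [hi0] using hadj.symm
    · have := h.adj (i - 1) (by omega)
      rw [show i - 1 + 1 = i by omega] at this
      simpa [hi0] using this

theorem IsPathSeq.reverse (h : IsPathSeq G S p f) :
    IsPathSeq G S p (fun i => f (p - 1 - i)) where
  mem i hi := h.mem _ (by omega)
  inj i hi j hj e := by
    have := h.inj _ (by omega) _ (by omega) e
    omega
  adj i hi := by
    have := h.adj (p - 1 - (i + 1)) (by omega)
    rw [show p - 1 - (i + 1) + 1 = p - 1 - i by omega] at this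
    exact this.symm

/-- Every neighbour in `S` of the first vertex of a longest path in `S` is on the path. -/
theorem IsPathSeq.exists_of_adj (h : IsPathSeq G S p f) (hp : 0 < p)
    (hmax : ∀ g, ¬ IsPathSeq G S (p + 1) g) {y : V} (hy : y ∈ S) (hadj : G.Adj (f 0) y) :
    ∃ i < p, f i = y := by
  by_contra! hne
  exact hmax _ (h.cons hp hy hadj hne)

open Classical in
theorem IsPathSeq.degIn_le (h : IsPathSeq G S p f) (hp : 0 < p)
    (hmax : ∀ g, ¬ IsPathSeq G S (p + 1) g) :
    degIn G S (f 0) ≤ #{i ∈ range p | G.Adj (f 0) (f i)} := by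
  refine (card_le_card (t := image f {i ∈ range p | G.Adj (f 0) (f i)}) ?_).trans card_image_le
  intro y hy
  rw [mem_filter] at hy
  obtain ⟨i, hi, rfl⟩ := h.exists_of_adj hp hmax hy.1 hy.2
  exact mem_image_of_mem _ (by simp [hi, hy.2])

/-- Dirac's rotation argument: a longest path whose ends have large degree closes up. -/
theorem IsPathSeq.exists_closed (h : IsPathSeq G S p f) (hp : 2 ≤ p)
    (hmax : ∀ g, ¬ IsPathSeq G S (p + 1) g) (hdeg : ∀ x ∈ S, #S < 2 * degIn G S x) :
    ∃ g, IsPathSeq G S p g ∧ G.Adj (g (p - 1)) (g 0) := by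
  classical
  have hle := h.le_card
  have d0 := (hdeg _ (h.mem 0 (by omega)))
  have d1 := (hdeg _ (h.mem (p - 1) (by omega)))
  have e0 := h.degIn_le (by omega) hmax
  have e1 := h.reverse.degIn_le (by omega) hmax
  simp only [Nat.sub_zero] at e1
  have c0 : #{i ∈ range p | G.Adj (f 0) (f i)} ≤ #{i ∈ range (p - 1) | G.Adj (f 0) (f (i + 1))} := by
    refine card_le_card_of_injOn (fun i => i - 1) ?_ ?_
    · intro i hi
      simp only [coe_filter, mem_range, Set.mem_ofPred_eq] at hi ⊢
      have : i ≠ 0 := by rintro rfl; exact G.loopless.irrefl _ hi.2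
      rw [show i - 1 + 1 = i by omega]
      exact ⟨by omega, hi.2⟩
    · intro i hi j hj e
      simp only [coe_filter, mem_range, Set.mem_ofPred_eq] at hi hj e
      have : i ≠ 0 := by rintro rfl; exact G.loopless.irrefl _ hi.2
      have : j ≠ 0 := by rintro rfl; exact G.loopless.irrefl _ hj.2
      omega
  have c1 : #{i ∈ range p | G.Adj (f (p - 1)) (f (p - 1 - i))} ≤
      #{i ∈ range (p - 1) | G.Adj (f (p - 1)) (f i)} := by
    refine card_le_card_of_injOn (fun i => p - 1 - i) ?_ ?_
    · intro i hi
      simp only [coe_filter, mem_range, Set.mem_ofPred_eq] at hi ⊢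
      have : i ≠ 0 := by rintro rfl; exact G.loopless.irrefl _ hi.2
      exact ⟨by omega, hi.2⟩
    · intro i hi j hj e
      simp only [coe_filter, mem_range, Set.mem_ofPred_eq] at hi hj e
      omega
  have hcard := card_union_add_card_inter {i ∈ range (p - 1) | G.Adj (f 0) (f (i + 1))}
    {i ∈ range (p - 1) | G.Adj (f (p - 1)) (f i)}
  have hun : #({i ∈ range (p - 1) | G.Adj (f 0) (f (i + 1))} ∪
      {i ∈ range (p - 1) | G.Adj (f (p - 1)) (f i)}) ≤ p - 1 := by
    refine (card_le_card (t := range (p - 1)) ?_).trans (card_range _).le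
    exact union_subset (filter_subset _ _) (filter_subset _ _)
  -- Pigeonhole: the two index sets have total size above `#S ≥ p`, but lie in `range (p - 1)`. A
  -- common `i` closes the path up as `f 0, …, f i, f (p - 1), …, f (i + 1)`.
  obtain ⟨i, hi⟩ := card_pos.1 (show 0 < #({i ∈ range (p - 1) | G.Adj (f 0) (f (i + 1))} ∩
      {i ∈ range (p - 1) | G.Adj (f (p - 1)) (f i)}) by omega)
  simp only [mem_inter, mem_filter, mem_range] at hi
  obtain ⟨⟨hi, a0⟩, -, a1⟩ := hi
  refine ⟨fun j => if j ≤ i then f j else f (p + i - j), ⟨?_, ?_, ?_⟩, ?_⟩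
  · intro j hj
    split_ifs
    · exact h.mem _ hj
    · exact h.mem _ (by omega)
  · intro a ha b hb e
    split_ifs at e
    all_goals
      have := h.inj _ (by omega) _ (by omega) e
      omega
  · intro j hj
    by_cases hj1 : j + 1 ≤ i
    · simpa [hj1, show j ≤ i by omega] using h.adj j hj
    · by_cases hj2 : j ≤ i
      · have : j = i := by omega
        subst this
        simpa [show p + j - (j + 1) = p - 1 by omega] using a1.symm
      · have := (h.adj (p + i - (j + 1)) (by omega)).symm
        rw [show p + i - (j + 1) + 1 = p + i - j by omega] at this
        simpa [hj1, hj2] using this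
  · simpa [show ¬ p - 1 ≤ i by omega, show p + i - (p - 1) = i + 1 by omega] using a0.symm

/-- Makes `f 1` an end of a longest path, so that `degIn_le` applies to it too. -/
theorem IsPathSeq.rotate (h : IsPathSeq G S p f) (hp : 2 ≤ p) (hc : G.Adj (f (p - 1)) (f 0)) :
    IsPathSeq G S p (fun i => if i + 1 < p then f (i + 1) else f 0) where
  mem i hi := by
    split_ifs
    · exact h.mem _ (by omega)
    · exact h.mem _ (by omega)
  inj a ha b hb e := by
    split_ifs at e
    all_goals first
      | omega
      | have := h.inj _ (by omega) _ (by omega) e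
        omega
  adj i hi := by
    by_cases h2 : i + 1 + 1 < p
    · simpa [hi, h2] using h.adj (i + 1) h2
    · rw [show p - 1 = i + 1 by omega] at hc
      simpa [hi, h2] using hc

/-- Bondy's argument: a cycle with two consecutive vertices of large degree contains cycles of
all smaller lengths. -/
theorem IsPathSeq.cycleGraph_isContained (h : IsPathSeq G S p f)
    (hc : G.Adj (f (p - 1)) (f 0)) {L : ℕ} (hL : 3 ≤ L) (hLp : L ≤ p)
    (hmax : ∀ g, ¬ IsPathSeq G S (p + 1) g) (hdeg : ∀ x ∈ S, #S < 2 * degIn G S x) :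
    cycleGraph L ⊑ G := by
  classical
  have hle := h.le_card
  have d0 := (hdeg _ (h.mem 0 (by omega)))
  have d1 := (hdeg _ (h.mem 1 (by omega)))
  have e0 := h.degIn_le (by omega) hmax
  have e1 := (h.rotate (by omega) hc).degIn_le (by omega) hmax
  simp only [zero_add, show 1 < p by omega, if_true] at e1
  have c0 : #{i ∈ range p | G.Adj (f 0) (f i)} ≤ #{i ∈ Ico 2 p | G.Adj (f 0) (f i)} + 1 := by
    refine (card_le_card (t := insert 1 {i ∈ Ico 2 p | G.Adj (f 0) (f i)}) ?_).trans
      (card_insert_le _ _)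
    intro i hi
    simp only [mem_filter, mem_range, mem_insert, mem_Ico] at hi ⊢
    have : i ≠ 0 := by rintro rfl; exact G.loopless.irrefl _ hi.2
    by_cases i = 1
    · left; assumption
    · exact Or.inr ⟨by omega, hi.2⟩
  -- Chosen so that edges `f 1 ~ f j` and `f 0 ~ f (φ j)` complete a cycle of length exactly `L`:
  -- either `f 0, f 1, f j, …, f (φ j)`, or `f 1, …, f (φ j), f 0, f (p - 1), …, f j`.
  let φ : ℕ → ℕ := fun j => if j + L - 3 < p then j + L - 3 else j + L - 1 - p
  have c1 : #{i ∈ range p | G.Adj (f 1) (if i + 1 < p then f (i + 1) else f 0)} ≤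
      #({i ∈ Ico 2 p | G.Adj (f 1) (f i)}.image φ) + 1 := by
    rw [card_image_of_injOn]
    · refine (card_le_card (t := insert (p - 1)
        ({i ∈ Ico 2 p | G.Adj (f 1) (f i)}.image (fun i => i - 1))) ?_).trans
        ((card_insert_le _ _).trans (Nat.add_le_add_right card_image_le 1))
      intro i hi
      simp only [mem_filter, mem_range, mem_insert, mem_image, mem_Ico] at hi ⊢
      by_cases hip : i + 1 < p
      · right
        rw [if_pos hip] at hi
        have : i ≠ 0 := by rintro rfl; exact G.loopless.irrefl _ hi.2
        exact ⟨i + 1, ⟨by omega, hi.2⟩, by omega⟩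
      · left
        omega
    · intro a ha b hb e
      simp only [coe_filter, mem_Ico, Set.mem_ofPred_eq, φ] at ha hb e
      split_ifs at e <;> omega
  have hcard := card_union_add_card_inter {i ∈ Ico 2 p | G.Adj (f 0) (f i)}
    ({i ∈ Ico 2 p | G.Adj (f 1) (f i)}.image φ)
  have hun : #({i ∈ Ico 2 p | G.Adj (f 0) (f i)} ∪
    ({i ∈ Ico 2 p | G.Adj (f 1) (f i)}.image φ)) ≤ p - 2 := by
    refine (card_le_card (t := Ico 2 p) ?_).trans (Nat.card_Ico _ _).le
    refine union_subset (filter_subset _ _) ?_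
    intro i hi
    simp only [mem_image, mem_filter, mem_Ico, φ] at hi ⊢
    obtain ⟨j, hj, rfl⟩ := hi
    split_ifs <;> omega
  -- Dropping the edge `f 0 ~ f 1` costs each degree one, leaving a total of at least `p - 1`
  -- indices among the `p - 2` of `Ico 2 p`.
  obtain ⟨i, hi⟩ := card_pos.1 (show 0 < #({i ∈ Ico 2 p | G.Adj (f 0) (f i)} ∩
    ({i ∈ Ico 2 p | G.Adj (f 1) (f i)}.image φ)) by omega)
  simp only [mem_inter, mem_filter, mem_image, mem_Ico, φ] at hi
  obtain ⟨⟨hi, a0⟩, j, ⟨hj, a1⟩, hij⟩ := hi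
  split_ifs at hij with hcase
  · refine ⟨cycleCopyOfSeq (by omega)
      (fun t => if t = 0 then f 0 else if t = 1 then f 1 else f (t + j - 2)) ?_ ?_ ?_⟩
    · intro a ha b hb e
      split_ifs at e
      all_goals first
        | omega
        | have := h.inj _ (by omega) _ (by omega) e
          omega
    · intro t ht
      rcases Nat.lt_or_ge t 2 with h2 | h2
      · interval_cases t
        · simpa using h.adj 0 (by omega)
        · simpa [show 2 + j - 2 = j by omega] using a1
      · have := h.adj (t + j - 2) (by omega)
        rw [show t + j - 2 + 1 = t + 1 + j - 2 by omega] at this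
        simpa [show t ≠ 0 by omega, show t ≠ 1 by omega] using this
    · simpa [show L - 1 ≠ 0 by omega, show L - 1 ≠ 1 by omega,
        show L - 1 + j - 2 = i by omega] using a0.symm
  · refine ⟨cycleCopyOfSeq (by omega)
      (fun t => if t < i then f (t + 1) else if t = i then f 0 else f (p + i - t)) ?_ ?_ ?_⟩
    · intro a ha b hb e
      split_ifs at e
      all_goals first
        | omega
        | have := h.inj _ (by omega) _ (by omega) e
          omega
    · intro t ht
      rcases lt_trichotomy (t + 1) i with h1 | h1 | h1
      · simpa [h1, show t < i by omega] using h.adj (t + 1) (by omega)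
      · simpa [h1, show t < i by omega] using a0.symm
      · rcases Nat.eq_or_lt_of_le (show i ≤ t by omega) with h2 | h2
        · subst h2
          simpa [show p + i - (i + 1) = p - 1 by omega] using hc.symm
        · have := (h.adj (p + i - (t + 1)) (by omega)).symm
          rw [show p + i - (t + 1) + 1 = p + i - t by omega] at this
          simpa [show ¬ t < i by omega, show t ≠ i by omega, show ¬ t + 1 < i by omega,
            show t + 1 ≠ i by omega] using this
    · simpa [show ¬ L - 1 < i by omega, show L - 1 ≠ i by omega, show 0 < i by omega,
        show p + i - (L - 1) = j by omega] using a1.symm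

theorem cycleGraph_isContained_of_degIn {L : ℕ} (hL : 3 ≤ L) (hS : 2 * L ≤ #S)
    (hdeg : ∀ x ∈ S, #S < 2 * degIn G S x) : cycleGraph L ⊑ G := by
  classical
  obtain ⟨x, hx⟩ := card_pos.1 (show 0 < #S by omega)
  have hex : ∃ p f, IsPathSeq G S p f := ⟨1, fun _ => x, by
    constructor
    · exact fun _ _ => hx
    · intros; omega
    · intros; omega⟩
  have hbd : ∀ q, (∃ f, IsPathSeq G S q f) → q ≤ #S := fun q ⟨f, hf⟩ => hf.le_card
  let p := Nat.findGreatest (fun q => ∃ f, IsPathSeq G S q f) #S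
  obtain ⟨f, hf⟩ : ∃ f, IsPathSeq G S p f :=
    Nat.findGreatest_spec (P := fun q => ∃ f, IsPathSeq G S q f) (hbd _ hex.choose_spec)
      hex.choose_spec
  have hmax : ∀ g, ¬ IsPathSeq G S (p + 1) g := fun g hg => by
    have : p + 1 ≤ p := Nat.le_findGreatest (P := fun q => ∃ f, IsPathSeq G S q f)
      (hbd _ ⟨g, hg⟩) ⟨g, hg⟩
    omega
  have hp0 : 0 < p := by
    refine Nat.findGreatest_pos.2 ⟨1, one_pos, by omega, fun _ => x, ?_⟩
    constructor
    · exact fun _ _ => hx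
    · intros; omega
    · intros; omega
  have hLp : L ≤ p := by
    have h1 := hf.degIn_le hp0 hmax
    have h2 := hdeg _ (hf.mem 0 hp0)
    have h3 : #{i ∈ range p | G.Adj (f 0) (f i)} ≤ p := (card_filter_le _ _).trans (card_range p).le
    omega
  obtain ⟨g, hg, hc⟩ := hf.exists_closed (by omega) hmax hdeg
  exact hg.cycleGraph_isContained hc hL hLp hmax hdeg

end LongestPath

/-! ### Edges spanned by a vertex set -/

section EdgeBound

variable {V : Type*} {G : SimpleGraph V}

/-- Twice the number of edges of `G` inside `S`. -/
noncomputable def degSum (G : SimpleGraph V) (S : Finset V) : ℕ := ∑ x ∈ S, degIn G S x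

open Classical in
theorem degSum_erase (S : Finset V) {x : V} (hx : x ∈ S) :
    degSum G S = degSum G (S.erase x) + 2 * degIn G S x := by
  have h1 : ∀ y, degIn G S y = degIn G (S.erase x) y + if G.Adj y x then 1 else 0 := by
    intro y
    simp only [degIn, card_filter]
    rw [← sum_erase_add _ _ hx]
  have h2 : degIn G S x = ∑ y ∈ S.erase x, if G.Adj y x then 1 else 0 := by
    rw [h1 x, if_neg (G.loopless.irrefl x), add_zero, degIn, card_filter]
    simp only [G.adj_comm]
  rw [degSum, ← sum_erase_add _ _ hx, sum_congr rfl (fun y _ => h1 y), sum_add_distrib, ← h2,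
    degSum]
  ring

theorem degIn_le_card (S : Finset V) (x : V) : degIn G S x ≤ #S := by
  classical exact card_filter_le _ _

/-- A graph without a cycle of length `L` has at most `s² / 4 + O(1)` edges on `s` vertices. -/
theorem degSum_le_of_free {L : ℕ} (hL : 3 ≤ L) (hfree : (cycleGraph L).Free G) (S : Finset V) :
    degSum G S ≤ 2 * (#S ^ 2 / 4) + 4 * L ^ 2 := by
  classical
  induction S using Finset.strongInduction with
  | H S ih =>
    rcases lt_or_ge #S (2 * L) with hS | hS
    · have : degSum G S ≤ #S * #S := by
        simpa [degSum] using sum_le_card_nsmul S (degIn G S) _ (fun x _ => degIn_le_card (G := G) S x)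
      calc degSum G S ≤ #S * #S := this
        _ ≤ 2 * L * (2 * L) := Nat.mul_le_mul hS.le hS.le
        _ = 4 * L ^ 2 := by ring
        _ ≤ _ := Nat.le_add_left _ _
    · by_contra! hlt
      refine hfree (cycleGraph_isContained_of_degIn hL hS (fun x hx => ?_))
      -- Deleting `x` loses at most `⌊#S / 2⌋` edges, which is exactly the drop of `⌊s² / 4⌋` from
      -- `s = #S` to `#S - 1`.
      by_contra! hx2
      have h1 := ih _ (erase_ssubset hx)
      have h2 := degSum_erase (G := G) S hx
      rw [card_erase_of_mem hx] at h1
      obtain ⟨m, hm⟩ := Nat.even_or_odd' #S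
      rcases hm with hm | hm
      · obtain ⟨r, rfl⟩ : ∃ r, m = r + 1 := ⟨m - 1, by omega⟩
        have e1 : #S ^ 2 / 4 = (r + 1) ^ 2 := by
          rw [hm, show (2 * (r + 1)) ^ 2 = (r + 1) ^ 2 * 4 by ring]; simp
        have e2 : (#S - 1) ^ 2 / 4 = r ^ 2 + r := by
          rw [hm, show (2 * (r + 1) - 1) = 2 * r + 1 by omega,
            show (2 * r + 1) ^ 2 = 1 + (r ^ 2 + r) * 4 by ring]; omega
        rw [e1] at hlt
        rw [e2] at h1
        nlinarith
      · have e1 : #S ^ 2 / 4 = m ^ 2 + m := by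
          rw [hm, show (2 * m + 1) ^ 2 = 1 + (m ^ 2 + m) * 4 by ring]; omega
        have e2 : (#S - 1) ^ 2 / 4 = m ^ 2 := by
          rw [hm, show (2 * m + 1 - 1) = 2 * m by omega, show (2 * m) ^ 2 = m ^ 2 * 4 by ring]
          simp
        rw [e1] at hlt
        rw [e2] at h1
        have : degIn G S x ≤ m := by omega
        nlinarith

end EdgeBound

/-! ### The bipartite benchmark -/

/-- The product of `⌊i / 2⌋` over `2 ≤ i ≤ n`. -/
def halfProd (n : ℕ) : ℕ := ∏ i ∈ Icc 2 n, i / 2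

theorem halfProd_succ {n : ℕ} (hn : 1 ≤ n) : halfProd (n + 1) = halfProd n * ((n + 1) / 2) :=
  prod_Icc_succ_top (by omega) _

theorem halfProd_eq_factorial (m : ℕ) : halfProd (2 * m + 2) = (m + 1).factorial * m.factorial ∧
    halfProd (2 * m + 3) = (m + 1).factorial * (m + 1).factorial := by
  have key : ∀ m, halfProd (2 * m + 2) = (m + 1).factorial * m.factorial →
      halfProd (2 * m + 3) = (m + 1).factorial * (m + 1).factorial := fun m h => by
    rw [halfProd_succ (by omega), h, show (2 * m + 2 + 1) / 2 = m + 1 by omega,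
      Nat.factorial_succ m]
    ring
  induction m with
  | zero =>
    have : halfProd (2 * 0 + 2) = 1 := by simp [halfProd]
    exact ⟨by simpa using this, key 0 (by simpa using this)⟩
  | succ m ih =>
    have : halfProd (2 * (m + 1) + 2) = (m + 1 + 1).factorial * (m + 1).factorial := by
      rw [show 2 * (m + 1) + 2 = 2 * m + 3 + 1 by ring, halfProd_succ (by omega), ih.2,
        show (2 * m + 3 + 1) / 2 = m + 1 + 1 by omega, Nat.factorial_succ (m + 1)]
      ring
    exact ⟨this, key _ this⟩

/-- Each step multiplies the left by `i = l + j + 1` and the right by `3 * (i / 2)`, which is at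
least `i` since `i ≥ 2`. -/
theorem choose_mul_factorial_mul_halfProd_le {l : ℕ} (hl : 1 ≤ l) (j : ℕ) :
    (l + j).choose j * j.factorial * halfProd l ≤ 3 ^ j * halfProd (l + j) := by
  induction j with
  | zero => simp
  | succ j ih =>
    rw [← add_assoc, halfProd_succ (by omega), Nat.factorial_succ]
    calc (l + j + 1).choose (j + 1) * ((j + 1) * j.factorial) * halfProd l
        = ((l + j + 1).choose (j + 1) * (j + 1)) * j.factorial * halfProd l := by ring
      _ = (l + j + 1) * ((l + j).choose j * j.factorial * halfProd l) := by
        rw [← Nat.add_one_mul_choose_eq]; ring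
      _ ≤ (3 * ((l + j + 1) / 2)) * (3 ^ j * halfProd (l + j)) :=
        Nat.mul_le_mul (by omega) ih
      _ = _ := by ring

/-- Relative to `halfProd n`, cycles missing `j` vertices contribute at most `3 ^ j / j!`, a term of
the series of `exp 3`. -/
theorem sum_choose_mul_halfProd_le (n : ℕ) :
    ∑ l ∈ Icc 3 n, (n.choose l * halfProd l : ℝ) ≤ Real.exp 3 * halfProd n := by
  have h1 : ∀ l ∈ Icc 3 n, (n.choose l * halfProd l : ℝ) ≤
      3 ^ (n - l) / (n - l).factorial * halfProd n := by
    intro l hl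
    rw [mem_Icc] at hl
    obtain ⟨j, rfl⟩ := Nat.exists_eq_add_of_le hl.2
    have := choose_mul_factorial_mul_halfProd_le (show 1 ≤ l by omega) j
    rw [Nat.add_sub_cancel_left, div_mul_eq_mul_div, le_div_iff₀ (by positivity),
      Nat.choose_symm_add]
    calc ((l + j).choose j * halfProd l * j.factorial : ℝ)
        = (((l + j).choose j * j.factorial * halfProd l : ℕ) : ℝ) := by push_cast; ring
      _ ≤ ((3 ^ j * halfProd (l + j) : ℕ) : ℝ) := by exact_mod_cast this
      _ = _ := by push_cast; ring
  refine (sum_le_sum h1).trans ?_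
  rw [← sum_mul]
  refine mul_le_mul_of_nonneg_right ?_ (by positivity)
  refine le_trans ?_ (Real.sum_le_exp_of_nonneg (by norm_num) (n + 1))
  rw [← sum_image (s := Icc 3 n) (g := fun l => n - l)
    (f := fun j => (3 : ℝ) ^ j / j.factorial)]
  · refine sum_le_sum_of_subset_of_nonneg ?_ (fun _ _ _ => by positivity)
    intro j hj
    simp only [mem_image, mem_Icc, mem_range] at hj ⊢
    omega
  · intro a ha b hb e
    simp only [coe_Icc, Set.mem_Icc] at ha hb e
    omega

/-! ### Counting Hamiltonian paths of a vertex set -/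

section PathCount

variable {V : Type*} {G : SimpleGraph V}

open Classical in
/-- The paths with `n + 1` vertices in `S` that start at `x`, as lists of vertices. -/
noncomputable def pathsFrom (G : SimpleGraph V) : ℕ → Finset V → V → Finset (List V)
  | 0, _, x => {[x]}
  | n + 1, S, x => {y ∈ S.erase x | G.Adj x y}.biUnion
      fun y => (pathsFrom G n (S.erase x) y).image (List.cons x)

theorem mem_pathsFrom (l : List V) (S : Finset V) (x : V) (hc : (x :: l).IsChain G.Adj)
    (hn : (x :: l).Nodup) (hS : ∀ y ∈ l, y ∈ S) : x :: l ∈ pathsFrom G l.length S x := by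
  classical
  induction l generalizing S x with
  | nil => simp [pathsFrom]
  | cons y l ih =>
    rw [List.isChain_cons_cons] at hc
    rw [List.nodup_cons] at hn
    have hS' : ∀ z ∈ y :: l, z ∈ S.erase x := fun z hz =>
      mem_erase.2 ⟨fun h => hn.1 (h ▸ hz), hS z hz⟩
    simp only [List.length_cons, pathsFrom, mem_biUnion, mem_filter, mem_image]
    exact ⟨y, ⟨hS' y (by simp), hc.1⟩, y :: l,
      ih _ _ hc.2 hn.2 (fun z hz => hS' z (by simp [hz])), rfl⟩

open Classical in
theorem card_pathsFrom_succ_le (n : ℕ) (S : Finset V) (x : V) :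
    #(pathsFrom G (n + 1) S x) ≤
      ∑ y ∈ S.erase x with G.Adj x y, #(pathsFrom G n (S.erase x) y) :=
  card_biUnion_le.trans (sum_le_sum fun _ _ => card_image_le)

/-- The bipartite edge count grows by the very factor that `halfProd` gains; this makes the
exponents below telescope. -/
theorem sq_div_four_succ (n : ℕ) : (n + 1) ^ 2 / 4 = n ^ 2 / 4 + (n + 1) / 2 := by
  obtain ⟨m, hm⟩ := Nat.even_or_odd' n
  rcases hm with rfl | rfl
  · rw [show (2 * m + 1) ^ 2 = 1 + (m ^ 2 + m) * 4 by ring, show (2 * m) ^ 2 = m ^ 2 * 4 by ring]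
    omega
  · rw [show (2 * m + 1 + 1) ^ 2 = (m ^ 2 + 2 * m + 1) * 4 by ring,
      show (2 * m + 1) ^ 2 = 1 + (m ^ 2 + m) * 4 by ring]
    omega

/-- If every vertex set `S` spans at most `⌊|S|² / 4⌋ + C` edges, then the number of Hamiltonian
paths of `S` from a given vertex is at most the corresponding number `halfProd |S|` for balanced
complete bipartite graphs, up to a factor that is governed by the edge deficit of `S`. -/
theorem card_pathsFrom_le_exp {C : ℝ}
    (hC : ∀ S : Finset V, (degSum G S / 2 : ℝ) ≤ ((#S ^ 2 / 4 : ℕ) : ℝ) + C) (n : ℕ)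
    (S : Finset V) (hS : #S = n + 2) (x : V) (hx : x ∈ S) :
    (#(pathsFrom G (n + 1) S x) : ℝ) ≤ halfProd (n + 2) *
      Real.exp (1 + C + (degSum G S / 2 - (((n + 2) ^ 2 / 4 : ℕ) : ℝ) - C) /
        ((n + 2) / 2 : ℕ)) := by
  classical
  induction n generalizing S x with
  | zero =>
    have h1 : #(pathsFrom G 1 S x) ≤ 1 := by
      refine (card_pathsFrom_succ_le 0 S x).trans ?_
      simp only [pathsFrom, card_singleton, sum_const, smul_eq_mul, mul_one]
      refine (card_filter_le _ _).trans ?_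
      rw [card_erase_of_mem hx, hS]
    have h2 : halfProd (0 + 2) = 1 := by simp [halfProd]
    rw [h2]
    refine le_trans (Nat.cast_le.2 h1) ?_
    -- For two vertices the exponent reduces to this edge count; the summand `1` in it is there for
    -- this case.
    have h3 : (0 : ℝ) ≤ degSum G S / 2 := by positivity
    norm_num
    linarith
  | succ n ih =>
    have hS' : #(S.erase x) = n + 2 := by rw [card_erase_of_mem hx, hS]; rfl
    have he := degSum_erase (G := G) S hx
    have hCS := hC (S.erase x)
    rw [hS'] at hCS
    have ht := sq_div_four_succ (n + 2)
    have hF := halfProd_succ (show 1 ≤ n + 2 by omega)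
    set d := degIn G S x with hd
    set h := (n + 2 + 1) / 2 with hh
    set h' := (n + 2) / 2 with hh'
    have hh1 : h' ≤ h := by omega
    have hh2 : 1 ≤ h' := by omega
    have hpos : (0 : ℝ) < h := by exact_mod_cast (by omega : 0 < h)
    have hpos' : (0 : ℝ) < h' := by exact_mod_cast (by omega : 0 < h')
    set A : ℝ := degSum G (S.erase x) / 2 - (((n + 2) ^ 2 / 4 : ℕ) : ℝ) - C with hA
    have hA0 : A ≤ 0 := by linarith
    -- The normalised edge excess `A` is nonpositive, so enlarging its denominator increases the
    -- quotient.
    have hAh : A / h' ≤ A / h := by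
      rw [div_le_div_iff₀ hpos' hpos]
      exact mul_le_mul_of_nonpos_left (by exact_mod_cast hh1) hA0
    have hdeg : #{y ∈ S.erase x | G.Adj x y} ≤ d :=
      card_le_card (filter_subset_filter _ (erase_subset _ _))
    have step : (#(pathsFrom G (n + 1 + 1) S x) : ℝ) ≤
        d * (halfProd (n + 2) * Real.exp (1 + C + A / h')) := by
      calc (#(pathsFrom G (n + 1 + 1) S x) : ℝ)
          ≤ ∑ y ∈ S.erase x with G.Adj x y, (#(pathsFrom G (n + 1) (S.erase x) y) : ℝ) := by
            exact_mod_cast card_pathsFrom_succ_le (n + 1) S x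
        _ ≤ #{y ∈ S.erase x | G.Adj x y} • (halfProd (n + 2) * Real.exp (1 + C + A / h')) :=
            sum_le_card_nsmul _ _ _ fun y hy => ih _ hS' y (mem_filter.1 hy).1
        _ ≤ _ := by
            rw [nsmul_eq_mul]
            exact mul_le_mul_of_nonneg_right (by exact_mod_cast hdeg) (by positivity)
    -- From `t ≤ exp (t - 1)` at `t = d / h`: a degree off the benchmark `h` changes the exponent
    -- linearly, as it changes the edge count.
    have hdh : (d : ℝ) ≤ h * Real.exp (d / h - 1) := by
      have := Real.add_one_le_exp ((d : ℝ) / h - 1)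
      rw [sub_add_cancel, div_le_iff₀ hpos] at this
      linarith
    have hexp : (degSum G S / 2 - (((n + 2 + 1) ^ 2 / 4 : ℕ) : ℝ) - C) / h =
        A / h + (d / h - 1) := by
      rw [ht, he, hA]
      push_cast
      field_simp
      ring
    refine step.trans ?_
    rw [show n + 1 + 2 = n + 2 + 1 by ring, hexp, hF]
    calc d * (halfProd (n + 2) * Real.exp (1 + C + A / h'))
        ≤ (h * Real.exp (d / h - 1)) * (halfProd (n + 2) * Real.exp (1 + C + A / h)) := by
          gcongr
      _ = _ := by
          rw [← add_assoc, Real.exp_add _ ((d : ℝ) / h - 1)]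
          push_cast
          ring

theorem card_pathsFrom_le {C : ℝ}
    (hC : ∀ S : Finset V, (degSum G S / 2 : ℝ) ≤ ((#S ^ 2 / 4 : ℕ) : ℝ) + C) (n : ℕ)
    (S : Finset V) (hS : #S = n + 2) (x : V) (hx : x ∈ S) :
    (#(pathsFrom G (n + 1) S x) : ℝ) ≤ halfProd (n + 2) * Real.exp (1 + C) := by
  refine (card_pathsFrom_le_exp hC n S hS x hx).trans ?_
  have := hC S
  rw [hS] at this
  have : (degSum G S / 2 - (((n + 2) ^ 2 / 4 : ℕ) : ℝ) - C) / ((n + 2) / 2 : ℕ) ≤ 0 :=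
    div_nonpos_of_nonpos_of_nonneg (by linarith) (by positivity)
  exact mul_le_mul_of_nonneg_left (Real.exp_le_exp.2 (by linarith)) (by positivity)

end PathCount

/-! ### Labelled and unlabelled cycles -/

section CycleCopies

variable {V : Type*} {G : SimpleGraph V}

/-- Allows a cycle to be re-rooted at any of its vertices. -/
theorem toSubgraph_comp_iso {W : Type*} {A : SimpleGraph W} (f : Copy A G) (e : A ≃g A) :
    (f.comp e.toCopy).toSubgraph = f.toSubgraph := by
  ext a b
  · simp only [Copy.toSubgraph, Subgraph.map_verts, Subgraph.verts_top, Set.image_univ,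
      Set.mem_range]
    exact ⟨fun ⟨i, hi⟩ => ⟨e i, hi⟩, fun ⟨i, hi⟩ => ⟨e.symm i, by
      rw [← hi]; exact congrArg f (e.apply_symm_apply i)⟩⟩
  · simp only [Copy.toSubgraph, Subgraph.map_adj, Relation.Map, Subgraph.top_adj]
    constructor
    · rintro ⟨i, j, h, rfl, rfl⟩
      exact ⟨e i, e j, e.map_adj_iff.2 h, rfl, rfl⟩
    · rintro ⟨i, j, h, rfl, rfl⟩
      exact ⟨e.symm i, e.symm j, e.symm.map_adj_iff.2 h,
        congrArg f (e.apply_symm_apply i), congrArg f (e.apply_symm_apply j)⟩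

/-- The rotation `i ↦ i + c` of the cycle. -/
def cycleGraphRotate (l : ℕ) (c : Fin (l + 2)) : cycleGraph (l + 2) ≃g cycleGraph (l + 2) where
  toEquiv := Equiv.addRight c
  map_rel_iff' := by
    intro a b
    simp [cycleGraph_adj]

theorem toSubgraph_adj_iff {W : Type*} {A : SimpleGraph W} (f : Copy A G) {a b : V} :
    f.toSubgraph.Adj a b ↔ ∃ i j, A.Adj i j ∧ f i = a ∧ f j = b := by
  simp only [Copy.toSubgraph, Subgraph.map_adj, Relation.Map, Subgraph.top_adj]
  rfl

/-- A copy of a cycle is determined by its underlying subgraph and its first two vertices. -/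
theorem copy_eq_of_toSubgraph_eq {l : ℕ} {f g : Copy (cycleGraph (l + 3)) G}
    (h : f.toSubgraph = g.toSubgraph) (h0 : f 0 = g 0) (h1 : f 1 = g 1) : f = g := by
  have key : ∀ i (hi : i + 1 < l + 3), f ⟨i, by omega⟩ = g ⟨i, by omega⟩ ∧
      f ⟨i + 1, hi⟩ = g ⟨i + 1, hi⟩ := by
    intro i
    induction i with
    | zero => exact fun _ => ⟨h0, h1⟩
    | succ i ih =>
      intro hi
      obtain ⟨ih0, ih1⟩ := ih (by omega)
      refine ⟨ih1, ?_⟩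
      have hadj : f.toSubgraph.Adj (f ⟨i + 1, by omega⟩) (f ⟨i + 1 + 1, hi⟩) :=
        (toSubgraph_adj_iff f).2 ⟨_, _, by rw [cycleGraph_adj_iff_val (by omega)]; simp, rfl, rfl⟩
      rw [h, toSubgraph_adj_iff] at hadj
      obtain ⟨u, v, huv, hu, hv⟩ := hadj
      rw [ih1] at hu
      have hu' := g.injective hu
      subst hu'
      rw [cycleGraph_adj_iff_val (by omega)] at huv
      dsimp only at huv
      obtain hv2 | hv2 : v.val = i + 1 + 1 ∨ v.val = i := by omega
      · rw [← hv]
        exact congrArg g (Fin.ext hv2)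
      · rw [show v = ⟨i, by omega⟩ from Fin.ext hv2, ← ih0] at hv
        have := Fin.val_eq_of_eq (f.injective hv)
        dsimp only at this
        omega
  ext i
  rcases Nat.lt_or_ge (i + 1) (l + 3) with hi | hi
  · exact (key i hi).1
  · have := (key (l + 1) (by omega)).2
    rwa [show (⟨l + 1 + 1, by omega⟩ : Fin (l + 3)) = i from Fin.ext (by dsimp only; omega)] at this

theorem labelledCopyCount_eq_card {W : Type*} [Fintype V] [Fintype W] (A : SimpleGraph W)
    [Fintype (Copy A G)] : G.labelledCopyCount A = Fintype.card (Copy A G) := by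
  simp only [labelledCopyCount, Fintype.card_eq_nat_card]

/-- Within one subgraph a copy is fixed by the images of `0` and `1`: `L` choices for the first,
then two neighbours on the cycle. -/
theorem labelledCopyCount_cycleGraph_le [Fintype V] {L : ℕ} (hL : 3 ≤ L) :
    G.labelledCopyCount (cycleGraph L) ≤ 2 * L * G.copyCount (cycleGraph L) := by
  classical
  obtain ⟨l, rfl⟩ := Nat.exists_eq_add_of_le' hL
  let inst : Fintype {f : cycleGraph (l + 3) →g G // Function.Injective f} := Fintype.ofFinite _
  rw [copyCount_eq_card_image_copyToSubgraph, labelledCopyCount_eq_card, ← card_univ]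
  refine card_le_mul_card_image _ _ ?_
  intro b hb
  obtain ⟨f₀, -, rfl⟩ := mem_image.1 hb
  let T : Finset (V × V) := univ.image fun q : Fin (l + 3) × Bool =>
    (f₀ q.1, f₀ (if q.2 then q.1 + 1 else q.1 - 1))
  have hT : #T ≤ 2 * (l + 3) := by
    refine card_image_le.trans ?_
    simp [mul_comm]
  refine (card_le_card_of_injOn (t := T) (fun f => (f 0, f 1)) ?_ ?_).trans hT
  · intro f hf
    have hf : f.toSubgraph = f₀.toSubgraph := by simpa using hf
    have hadj : f.toSubgraph.Adj (f 0) (f 1) :=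
      (toSubgraph_adj_iff f).2 ⟨0, 1, by rw [cycleGraph_adj]; simp, rfl, rfl⟩
    rw [hf, toSubgraph_adj_iff] at hadj
    obtain ⟨u, v, huv, hu, hv⟩ := hadj
    simp only [T, coe_image, coe_univ, Set.image_univ, Set.mem_range, Prod.mk.injEq, Prod.exists]
    rcases cycleGraph_adj.1 huv with e | e
    · refine ⟨u, false, hu, ?_⟩
      rw [← hv, ← e]
      simp
    · refine ⟨u, true, hu, ?_⟩
      rw [← hv, ← e]
      simp
  · intro f hf g hg e
    have hf : f.toSubgraph = f₀.toSubgraph := by simpa using hf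
    have hg : g.toSubgraph = f₀.toSubgraph := by simpa using hg
    rw [Prod.mk.injEq] at e
    exact copy_eq_of_toSubgraph_eq (hf.trans hg.symm) e.1 e.2

/-- The copy of a cycle in a complete bipartite graph that alternates between two injective
sequences. -/
def alternatingCycleCopy {a m : ℕ} (hm : 2 ≤ m) (σ : Fin m ↪ Fin a) (τ : Equiv.Perm (Fin m)) :
    Copy (cycleGraph (2 * m)) (completeBipartiteGraph (Fin a) (Fin m)) :=
  have hm0 : 0 < m := by omega
  cycleCopyOfSeq (by omega)
    -- The reduction mod `m` only makes the sequence total; it is trivial for `t < 2 * m`.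
    (fun t => if t % 2 = 0 then Sum.inl (σ ⟨t / 2 % m, Nat.mod_lt _ hm0⟩)
      else Sum.inr (τ ⟨t / 2 % m, Nat.mod_lt _ hm0⟩))
    (by
      intro i hi j hj e
      have h1 : i / 2 % m = i / 2 := Nat.mod_eq_of_lt (by omega)
      have h2 : j / 2 % m = j / 2 := Nat.mod_eq_of_lt (by omega)
      split_ifs at e with c1 c2 c2
      · have := Fin.val_eq_of_eq (σ.injective (Sum.inl_injective e))
        dsimp only at this
        omega
      · have := Fin.val_eq_of_eq (τ.injective (Sum.inr_injective e))
        dsimp only at this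
        omega)
    (by
      intro i hi
      rcases Nat.mod_two_eq_zero_or_one i with h | h
      · simp [h, show (i + 1) % 2 = 1 by omega]
      · simp [h, show (i + 1) % 2 = 0 by omega])
    (by simp [show (2 * m - 1) % 2 = 1 by omega])

theorem alternatingCycleCopy_apply {a m : ℕ} (hm : 2 ≤ m) (σ : Fin m ↪ Fin a)
    (τ : Equiv.Perm (Fin m)) (t : Fin (2 * m)) : alternatingCycleCopy hm σ τ t =
      if t.val % 2 = 0 then Sum.inl (σ ⟨t / 2 % m, Nat.mod_lt _ (by omega)⟩)
      else Sum.inr (τ ⟨t / 2 % m, Nat.mod_lt _ (by omega)⟩) := rfl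

theorem alternatingCycleCopy_injective {a m : ℕ} (hm : 2 ≤ m) :
    Function.Injective fun q : (Fin m ↪ Fin a) × Equiv.Perm (Fin m) =>
      alternatingCycleCopy hm q.1 q.2 := by
  rintro ⟨σ, τ⟩ ⟨σ', τ'⟩ e
  have key : ∀ t : Fin (2 * m), alternatingCycleCopy hm σ τ t = alternatingCycleCopy hm σ' τ' t :=
    fun t => DFunLike.congr_fun e t
  rw [Prod.mk.injEq]
  constructor
  · ext i
    have := key ⟨2 * i, by omega⟩
    rw [alternatingCycleCopy_apply, alternatingCycleCopy_apply] at this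
    simpa [Nat.mod_eq_of_lt i.isLt] using congrArg (Sum.elim Fin.val Fin.val) this
  · ext i
    have := key ⟨2 * i + 1, by omega⟩
    rw [alternatingCycleCopy_apply, alternatingCycleCopy_apply] at this
    simpa [Nat.mod_eq_of_lt i.isLt, show (2 * (i : ℕ) + 1) % 2 = 1 by omega,
      show (2 * (i : ℕ) + 1) / 2 = i by omega] using congrArg (Sum.elim Fin.val Fin.val) this

theorem le_labelledCopyCount_completeBipartite {a m : ℕ} (hm : 2 ≤ m) :
    a.descFactorial m * m.factorial ≤
      (completeBipartiteGraph (Fin a) (Fin m)).labelledCopyCount (cycleGraph (2 * m)) := by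
  classical
  let inst : Fintype (Copy (cycleGraph (2 * m)) (completeBipartiteGraph (Fin a) (Fin m))) :=
    Fintype.ofInjective _ DFunLike.coe_injective
  rw [labelledCopyCount_eq_card]
  simpa [Fintype.card_embedding_eq, Fintype.card_perm] using
    Fintype.card_le_of_injective _ (alternatingCycleCopy_injective (a := a) hm)

end CycleCopies

/-! ### Upper and lower bounds on the number of cycles -/

/-- Each cycle is counted by a Hamiltonian path of its vertex set from a chosen vertex. -/
theorem copyCount_cycleGraph_le {V : Type*} [Fintype V] [Nonempty V] {G : SimpleGraph V} {C : ℝ}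
    (hC : ∀ S : Finset V, (degSum G S / 2 : ℝ) ≤ ((#S ^ 2 / 4 : ℕ) : ℝ) + C) (l : ℕ) :
    (G.copyCount (cycleGraph (l + 2)) : ℝ) ≤
      (Fintype.card V).choose (l + 2) * (halfProd (l + 2) * Real.exp (1 + C)) := by
  classical
  have hstart : ∀ S : Finset V, ∃ x, S.Nonempty → x ∈ S := fun S => by
    by_cases hS : S.Nonempty
    · exact ⟨_, fun _ => hS.choose_spec⟩
    · exact ⟨Classical.arbitrary V, fun h => absurd h hS⟩
  choose x hx using hstart
  have hcount : G.copyCount (cycleGraph (l + 2)) ≤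
      #((powersetCard (l + 2) univ).biUnion fun S => pathsFrom G (l + 1) S (x S)) := by
    rw [copyCount]
    -- Relates a cycle to the vertex lists that traverse it: each cycle has one starting at the root
    -- `x S`, and a list determines its cycle.
    refine card_le_card_of_forall_subsingleton
      (fun G' p => ∃ f : Copy (cycleGraph (l + 2)) G, f.toSubgraph = G' ∧ List.ofFn f = p) ?_ ?_
    · intro G' hG'
      have hG' : Nonempty (cycleGraph (l + 2) ≃g G'.coe) := by simpa using hG'
      obtain ⟨f₀, -, hf₀⟩ := Copy.toSubgraph_surjOn hG'
      set S : Finset V := univ.image f₀ with hS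
      have hcard : #S = l + 2 := by
        rw [hS, card_image_of_injective _ (show Function.Injective f₀ from f₀.injective), card_univ,
          Fintype.card_fin]
      obtain ⟨c, -, hc⟩ := mem_image.1 (hx S (card_pos.1 (by omega)))
      let f := f₀.comp (cycleGraphRotate l c).toCopy
      have hf0 : f 0 = x S := by
        rw [← hc]
        exact congrArg f₀ (zero_add c)
      refine ⟨List.ofFn f, mem_biUnion.2 ⟨S, by simp [mem_powersetCard, hcard], ?_⟩, f, ?_, rfl⟩
      · have hchain : (List.ofFn f).IsChain G.Adj := by
          rw [List.isChain_ofFn]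
          intro i hi
          exact f.toHom.map_adj ((cycleGraph_adj_iff_val (by omega) _ _).2 (Or.inl rfl))
        have hnodup : (List.ofFn f).Nodup := List.nodup_ofFn.2 f.injective
        rw [List.ofFn_succ] at hchain hnodup ⊢
        rw [hf0] at hchain hnodup ⊢
        convert mem_pathsFrom _ S _ hchain hnodup ?_ using 2
        · simp
        · intro y hy
          obtain ⟨i, rfl⟩ := (List.mem_ofFn' _ _).1 hy
          exact mem_image_of_mem _ (mem_univ _)
      · rw [← hf₀]
        exact toSubgraph_comp_iso f₀ (cycleGraphRotate l c)
    · rintro p - G₁ ⟨-, f, hf, hfp⟩ G₂ ⟨-, g, hg, hgp⟩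
      have : f = g := DFunLike.coe_injective (List.ofFn_injective (hfp.trans hgp.symm))
      rw [← hf, ← hg, this]
  calc (G.copyCount (cycleGraph (l + 2)) : ℝ)
      ≤ ∑ S ∈ powersetCard (l + 2) univ, (#(pathsFrom G (l + 1) S (x S)) : ℝ) := by
        exact_mod_cast hcount.trans card_biUnion_le
    _ ≤ #(powersetCard (l + 2) (univ : Finset V)) • (halfProd (l + 2) * Real.exp (1 + C)) := by
        refine sum_le_card_nsmul _ _ _ fun S hS => ?_
        have hcard := (mem_powersetCard.1 hS).2
        exact card_pathsFrom_le hC l S hcard _ (hx S (card_pos.1 (by omega)))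
    _ = _ := by rw [card_powersetCard, card_univ, nsmul_eq_mul]

theorem numCycles_le {V : Type*} [Fintype V] [Nonempty V] {G : SimpleGraph V} {C : ℝ}
    (hC : ∀ S : Finset V, (degSum G S / 2 : ℝ) ≤ ((#S ^ 2 / 4 : ℕ) : ℝ) + C) :
    (numCycles G : ℝ) ≤ Real.exp (4 + C) * halfProd (Fintype.card V) := by
  rw [numCycles, Nat.cast_sum]
  calc ∑ l ∈ Icc 3 (Fintype.card V), (G.copyCount (cycleGraph l) : ℝ)
      ≤ ∑ l ∈ Icc 3 (Fintype.card V),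
          Real.exp (1 + C) * ((Fintype.card V).choose l * halfProd l : ℝ) := by
        refine sum_le_sum fun l hl => ?_
        obtain ⟨j, rfl⟩ := Nat.exists_eq_add_of_le' (show 2 ≤ l by rw [mem_Icc] at hl; omega)
        refine (copyCount_cycleGraph_le hC j).trans_eq ?_
        ring
    _ ≤ Real.exp (1 + C) * (Real.exp 3 * halfProd (Fintype.card V)) := by
        rw [← mul_sum]
        exact mul_le_mul_of_nonneg_left (sum_choose_mul_halfProd_le _) (Real.exp_pos _).le
    _ = _ := by
        rw [← mul_assoc, ← Real.exp_add]
        ring_nf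

/-- Cycles of length `2 * (n / 2)` suffice: their labelled copies are counted by factorials, and
dividing by twice the length, `4 * (n / 2)`, leaves at least `halfProd n / 4`. -/
theorem halfProd_le_numCycles {n : ℕ} (hn : 4 ≤ n) :
    halfProd n ≤ 4 * numCycles (balancedCompleteBipartite n) := by
  obtain ⟨m, hm⟩ : ∃ m, n / 2 = m + 1 := ⟨n / 2 - 1, by omega⟩
  have h1 := le_labelledCopyCount_completeBipartite (a := (n + 1) / 2)
    (show 2 ≤ n / 2 by omega)
  have h2 := labelledCopyCount_cycleGraph_le (G := balancedCompleteBipartite n)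
    (show 3 ≤ 2 * (n / 2) by omega)
  have h3 : (balancedCompleteBipartite n).copyCount (cycleGraph (2 * (n / 2))) ≤
      numCycles (balancedCompleteBipartite n) := by
    refine single_le_sum (f := fun l => (balancedCompleteBipartite n).copyCount (cycleGraph l))
      (fun _ _ => Nat.zero_le _) ?_
    simp only [Fintype.card_sum, Fintype.card_fin, mem_Icc]
    omega
  have h4 := (h1.trans h2).trans (Nat.mul_le_mul_left _ h3)
  generalize numCycles (balancedCompleteBipartite n) = c at h4
  rw [hm] at h4
  rcases Nat.even_or_odd' n with ⟨r, hr | hr⟩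
  · rw [show (n + 1) / 2 = m + 1 by omega, Nat.descFactorial_self,
      Nat.factorial_succ m] at h4
    rw [show n = 2 * m + 2 by omega, (halfProd_eq_factorial m).1, Nat.factorial_succ]
    refine le_of_mul_le_mul_left (a := m + 1) ?_ (by omega)
    calc _ = (m + 1) * m.factorial * ((m + 1) * m.factorial) := by ring
      _ ≤ _ := h4
      _ = _ := by ring
  · have h5 := Nat.factorial_mul_descFactorial (show m + 1 ≤ m + 1 + 1 by omega)
    rw [Nat.add_sub_cancel_left, Nat.factorial_one, one_mul] at h5
    rw [show (n + 1) / 2 = m + 1 + 1 by omega, h5] at h4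
    rw [show n = 2 * m + 3 by omega, (halfProd_eq_factorial m).2]
    refine le_of_mul_le_mul_left (a := m + 1) ?_ (by omega)
    calc (m + 1) * ((m + 1).factorial * (m + 1).factorial)
        ≤ (m + 1 + 1) * ((m + 1).factorial * (m + 1).factorial) :=
          Nat.mul_le_mul_right _ (by omega)
      _ = (m + 1 + 1).factorial * (m + 1).factorial := by
          rw [Nat.factorial_succ (m + 1)]; ring
      _ ≤ _ := h4
      _ = _ := by ring

theorem theorem6p1 (k : ℕ) (hk : 2 ≤ k) :
    ∃ α : ℝ, 1 ≤ α ∧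
      ∀ (n : ℕ), 4 ≤ n →
        ∀ (V : Type*) [Fintype V], Fintype.card V = n →
          ∀ G : SimpleGraph V, IsCycleMaximalFree (SimpleGraph.cycleGraph (2 * k + 1)) G →
            (numCycles G : ℝ) ≤ α * (numCycles (balancedCompleteBipartite n) : ℝ) := by
  -- Half of the error `4 * L ^ 2` in `degSum_le_of_free` at `L = 2 * k + 1`, since `degSum` counts
  -- edges twice.
  set C : ℝ := 2 * (2 * k + 1) ^ 2 with hCdef
  refine ⟨4 * Real.exp (4 + C), ?_, ?_⟩
  · have : (1 : ℝ) ≤ Real.exp (4 + C) := Real.one_le_exp (by positivity)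
    linarith
  intro n hn V _ hV G hG
  have : Nonempty V := Fintype.card_pos_iff.1 (by omega)
  have hC : ∀ S : Finset V, (degSum G S / 2 : ℝ) ≤ ((#S ^ 2 / 4 : ℕ) : ℝ) + C := by
    intro S
    have h : (degSum G S : ℝ) ≤ ((2 * (#S ^ 2 / 4) + 4 * (2 * k + 1) ^ 2 : ℕ) : ℝ) := by
      exact_mod_cast degSum_le_of_free (by omega) hG.1 S
    rw [Nat.cast_add, Nat.cast_mul] at h
    push_cast at h ⊢
    rw [hCdef]
    linarith
  calc (numCycles G : ℝ) ≤ Real.exp (4 + C) * halfProd n := hV ▸ numCycles_le hC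
    _ ≤ Real.exp (4 + C) * (4 * numCycles (balancedCompleteBipartite n)) := by
        refine mul_le_mul_of_nonneg_left ?_ (Real.exp_pos _).le
        exact_mod_cast halfProd_le_numCycles hn
    _ = _ := by ring
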